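/- Let $\lambda$ be a cardinal, let $\mathbb{K}\in\{\mathbb{R},\mathbb{C}\}$, and let $\mathbf{Hilb}_\lambda^{\le 1}$ be the category whose objects are the Hilbert spaces over $\mathbb{K}$ of dimension (the cardinality of an orthonormal basis) at most $\lambda$ and whose morphisms are the linear maps of norm at most $1$. Let $T:\mathbf{Set}\to\mathbf{Set}$ be an endofunctor which factors through $\mathbf{Hilb}_\lambda^{\le 1}$, i.e. there are functors $F:\mathbf{Set}\to\mathbf{Hilb}_\lambda^{\le 1}$ and $G:\mathbf{Hilb}_\lambda^{\le 1}\to\mathbf{Set}$ with $T\cong G\circ F$. Then $T$ is algebraically compact: there is an initial $T$-algebra $\omega:T\Omega\to\Omega$ whose structure map $\omega$ is invertible and such that $\omega^{-1}:\Omega\to T\Omega$ is a final $T$-coalgebra. -/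

import Mathlib

open CategoryTheory

universe u v

noncomputable section

/-- The dimension of a Hilbert space `E`: the (least) cardinality of a Hilbert basis of `E`, that
is, of an orthonormal family whose linear span is dense. -/
def hilbertDim (𝕜 : Type) [RCLike 𝕜] (E : Type v) [NormedAddCommGroup E]
    [InnerProductSpace 𝕜 E] : Cardinal.{v} :=
  sInf {c : Cardinal.{v} | ∃ ι : Type v, Nonempty (HilbertBasis ι 𝕜 E) ∧ Cardinal.mk ι = c}

/-- The infimum in the definition of the dimension is attained. -/
theorem hilbertDim_le_iff (𝕜 : Type) [RCLike 𝕜] (E : Type v) [NormedAddCommGroup E]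
    [InnerProductSpace 𝕜 E] [CompleteSpace E] (c : Cardinal.{v}) :
    hilbertDim 𝕜 E ≤ c ↔ ∃ ι : Type v, Nonempty (HilbertBasis ι 𝕜 E) ∧ Cardinal.mk ι ≤ c := by
  constructor
  · intro h
    have hne : {c : Cardinal.{v} | ∃ ι : Type v,
        Nonempty (HilbertBasis ι 𝕜 E) ∧ Cardinal.mk ι = c}.Nonempty := by
      obtain ⟨w, b, -⟩ := exists_hilbertBasis 𝕜 E
      exact ⟨_, w, ⟨b⟩, rfl⟩
    obtain ⟨ι, hb, hι⟩ := csInf_mem hne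
    exact ⟨ι, hb, hι.le.trans h⟩
  · rintro ⟨ι, hb, hι⟩
    refine le_trans ?_ hι
    unfold hilbertDim
    exact csInf_le' ⟨ι, hb, rfl⟩

/-- The Hilbert spaces over `𝕜` (which is `ℝ` or `ℂ`) of dimension at most `c`. -/
structure HilbLE (𝕜 : Type) [RCLike 𝕜] (c : Cardinal.{v}) : Type (v + 1) where
  carrier : Type v
  [normedAddCommGroup : NormedAddCommGroup carrier]
  [innerProductSpace : InnerProductSpace 𝕜 carrier]
  [completeSpace : CompleteSpace carrier]
  dim_le : hilbertDim 𝕜 carrier ≤ c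

namespace HilbLE

variable {𝕜 : Type} [RCLike 𝕜] {c : Cardinal.{v}}

instance : CoeSort (HilbLE 𝕜 c) (Type v) := ⟨HilbLE.carrier⟩

attribute [instance] normedAddCommGroup innerProductSpace completeSpace

/-- Morphisms of Hilbert spaces: linear maps of norm at most `1`. -/
@[ext]
structure Hom (X Y : HilbLE 𝕜 c) : Type v where
  map : X →L[𝕜] Y
  norm_le : ‖map‖ ≤ 1

instance : Category.{v} (HilbLE 𝕜 c) where
  Hom X Y := Hom X Y
  id X := ⟨ContinuousLinearMap.id 𝕜 X, ContinuousLinearMap.norm_id_le⟩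
  comp f g := ⟨g.map.comp f.map,
    (ContinuousLinearMap.opNorm_comp_le _ _).trans
      (mul_le_one₀ g.norm_le (norm_nonneg _) f.norm_le)⟩
  id_comp _ := rfl
  comp_id _ := rfl
  assoc _ _ _ := rfl

end HilbLE

/-- An endofunctor `T` is algebraically compact if it has an initial algebra `ω : T Ω ⟶ Ω`
whose structure map is invertible and such that `ω⁻¹ : Ω ⟶ T Ω` is a final `T`-coalgebra. -/
def IsAlgebraicallyCompact {C : Type u} [Category.{v} C] (T : C ⥤ C) : Prop :=
  ∃ (Ω : C) (ω : T.obj Ω ≅ Ω),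
    Nonempty (Limits.IsInitial (⟨Ω, ω.hom⟩ : Endofunctor.Algebra T)) ∧
    Nonempty (Limits.IsTerminal (⟨Ω, ω.inv⟩ : Endofunctor.Coalgebra T))

end

/-! By `IsAlgebraicallyCompact.comp_swap` it suffices to treat an endofunctor `S` of Hilbert spaces.
A universal space `Z` contains `S Z` through an isometry `j` with retraction `r = j†`. Idempotent
contractions are orthogonal projections (`eq_proj_of_idem`), so `S` sends closed subspaces of `Z` to
closed subspaces of `S Z`. This gives a monotone operator on the complete lattice of closed
subspaces of `Z`; its least fixed point `U` satisfies `S U ≅ U`. Algebra maps out of `U` are the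
solutions of `h = r ≫ S.map h ≫ a` supported on `U`. They exist by Zorn and gluing (`exists_glue`),
and are unique because the agreement locus of two solutions is stable. Finality follows by taking
adjoints: conjugating `S` by `†` does not change its action on projections, so the same `U` serves.
-/

noncomputable section

/-! ### Dimension of closed subspaces -/

/-- An orthonormal family has at most as many members as a Hilbert basis. -/
theorem Orthonormal.mk_le_mk_hilbertBasis {𝕜 : Type} [RCLike 𝕜] {E : Type v}
    [NormedAddCommGroup E] [InnerProductSpace 𝕜 E] {ι κ : Type v} {w : ι → E}
    (hw : Orthonormal 𝕜 w) (b : HilbertBasis κ 𝕜 E) : Cardinal.mk ι ≤ Cardinal.mk κ := by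
  cases finite_or_infinite κ with
  | inl _ =>
    have := Fintype.ofFinite κ
    have h := hw.linearIndependent.cardinal_le_rank
    rwa [← b.toOrthonormalBasis.toBasis.mk_eq_rank''] at h
  | inr _ =>
    have hex : ∀ i, ∃ k, inner 𝕜 (w i) (b k) ≠ 0 := by
      intro i
      by_contra! hi
      refine hw.ne_zero i (b.repr.injective ?_)
      ext k
      rw [b.repr_apply_apply, ← inner_conj_symm, hi k]
      simp
    choose f hf using hex
    -- Bessel: a vector has only countably many nonzero coefficients in an orthonormal family.
    have hc : ∀ k, Cardinal.mk (f ⁻¹' {k}) ≤ Cardinal.aleph0 := by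
      intro k
      rw [Cardinal.le_aleph0_iff_set_countable]
      refine (hw.inner_products_summable (b k)).countable_support.mono ?_
      rintro i rfl
      simpa using hf i
    calc Cardinal.mk ι ≤ Cardinal.mk κ * Cardinal.aleph0 :=
          Cardinal.mk_le_mk_mul_of_mk_preimage_le f hc
      _ = Cardinal.mk κ := Cardinal.mul_eq_left (Cardinal.aleph0_le_mk κ)
          (Cardinal.aleph0_le_mk κ) Cardinal.aleph0_ne_zero

/-- The dimension of a closed subspace is at most the dimension of the whole space. -/
theorem ClosedSubmodule.hilbertDim_le {𝕜 : Type} [RCLike 𝕜] {E : Type v}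
    [NormedAddCommGroup E] [InnerProductSpace 𝕜 E] [CompleteSpace E]
    (V : ClosedSubmodule 𝕜 E) [CompleteSpace V.toSubmodule] :
    hilbertDim 𝕜 V.toSubmodule ≤ hilbertDim 𝕜 E := by
  obtain ⟨κ, ⟨b⟩, hκ⟩ := (hilbertDim_le_iff 𝕜 E _).1 le_rfl
  obtain ⟨s, b', -⟩ := exists_hilbertBasis 𝕜 V.toSubmodule
  refine (hilbertDim_le_iff 𝕜 _ _).2 ⟨s, ⟨b'⟩, le_trans ?_ hκ⟩
  exact (b'.orthonormal.comp_linearIsometry V.toSubmodule.subtypeₗᵢ).mk_le_mk_hilbertBasis b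

/-! ### Contractions, adjoints and projections -/

namespace HilbLE

variable {𝕜 : Type} [RCLike 𝕜] {c : Cardinal.{v}} {X Y Z A : HilbLE.{v} 𝕜 c}

/-- The continuous linear map underlying a morphism. -/
def toCLM (f : X ⟶ Y) : X →L[𝕜] Y := Hom.map f

/-- A contraction, as a morphism. -/
def ofCLM (f : X →L[𝕜] Y) (hf : ‖f‖ ≤ 1) : X ⟶ Y := Hom.mk f hf

@[simp] theorem toCLM_ofCLM (f : X →L[𝕜] Y) (hf : ‖f‖ ≤ 1) : toCLM (ofCLM f hf) = f := rfl

@[simp] theorem toCLM_id (x : X) : toCLM (𝟙 X) x = x := rfl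

@[simp] theorem toCLM_comp (f : X ⟶ Y) (g : Y ⟶ Z) (x : X) :
    toCLM (f ≫ g) x = toCLM g (toCLM f x) := rfl

theorem norm_toCLM_le (f : X ⟶ Y) : ‖toCLM f‖ ≤ 1 := Hom.norm_le f

theorem norm_toCLM_apply_le (f : X ⟶ Y) (x : X) : ‖toCLM f x‖ ≤ ‖x‖ := by
  simpa using (toCLM f).le_of_opNorm_le (norm_toCLM_le f) x

theorem hom_ext {f g : X ⟶ Y} (h : ∀ x, toCLM f x = toCLM g x) : f = g :=
  Hom.ext (ContinuousLinearMap.ext h)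

/-- The adjoint of a morphism. -/
def dagger (f : X ⟶ Y) : Y ⟶ X :=
  ofCLM (toCLM f).adjoint (by
    rw [LinearIsometryEquiv.norm_map]
    exact norm_toCLM_le f)

theorem inner_dagger_left (f : X ⟶ Y) (x : X) (y : Y) :
    inner 𝕜 (toCLM (dagger f) y) x = inner 𝕜 y (toCLM f x) :=
  ContinuousLinearMap.adjoint_inner_left _ _ _

@[simp] theorem dagger_dagger (f : X ⟶ Y) : dagger (dagger f) = f :=
  Hom.ext (ContinuousLinearMap.adjoint_adjoint (toCLM f))

@[simp] theorem dagger_id (X : HilbLE.{v} 𝕜 c) : dagger (𝟙 X) = 𝟙 X :=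
  hom_ext fun x => ext_inner_right 𝕜 fun y => by simp [inner_dagger_left]

@[simp] theorem dagger_comp (f : X ⟶ Y) (g : Y ⟶ Z) : dagger (f ≫ g) = dagger g ≫ dagger f :=
  hom_ext fun x => ext_inner_right 𝕜 fun y => by simp [inner_dagger_left]

/-- The closed subspace on which two morphisms agree. -/
def eqLocus (f g : X ⟶ Y) : ClosedSubmodule 𝕜 X where
  toSubmodule := LinearMap.eqLocus (toCLM f : X →ₗ[𝕜] Y) (toCLM g : X →ₗ[𝕜] Y)
  isClosed' := isClosed_eq (toCLM f).continuous (toCLM g).continuous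

theorem mem_eqLocus {f g : X ⟶ Y} {x : X} : x ∈ eqLocus f g ↔ toCLM f x = toCLM g x := Iff.rfl

/-- The orthogonal projection to a closed subspace. -/
def proj (V : ClosedSubmodule 𝕜 X) : X ⟶ X :=
  ofCLM V.toSubmodule.starProjection V.toSubmodule.starProjection_norm_le

theorem proj_mem (V : ClosedSubmodule 𝕜 X) (x : X) : toCLM (proj V) x ∈ V :=
  V.toSubmodule.starProjection_apply_mem x

theorem proj_apply_eq_self_iff {V : ClosedSubmodule 𝕜 X} {x : X} :
    toCLM (proj V) x = x ↔ x ∈ V :=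
  Submodule.starProjection_eq_self_iff

theorem proj_comp_eq_iff {V : ClosedSubmodule 𝕜 X} {f g : X ⟶ Y} :
    proj V ≫ f = proj V ≫ g ↔ V ≤ eqLocus f g := by
  constructor
  · intro h x hx
    have := congrArg (fun k => toCLM k x) h
    simpa [proj_apply_eq_self_iff.2 hx, mem_eqLocus] using this
  · intro h
    exact hom_ext fun x => mem_eqLocus.1 (h (proj_mem V x))

theorem proj_comp_proj {V W : ClosedSubmodule 𝕜 X} (h : V ≤ W) : proj V ≫ proj W = proj V :=
  hom_ext fun x => proj_apply_eq_self_iff.2 (h (proj_mem V x))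

@[simp] theorem proj_idem (V : ClosedSubmodule 𝕜 X) : proj V ≫ proj V = proj V :=
  proj_comp_proj le_rfl

@[simp] theorem dagger_proj (V : ClosedSubmodule 𝕜 X) : dagger (proj V) = proj V :=
  hom_ext fun x => ext_inner_right 𝕜 fun y => by
    rw [inner_dagger_left]
    exact (V.toSubmodule.inner_starProjection_left_eq_right x y).symm

/-- An idempotent contraction is an orthogonal projection. -/
theorem eq_proj_of_idem {e : X ⟶ X} (he : e ≫ e = e) : e = proj (eqLocus e (𝟙 X)) := by
  refine hom_ext fun x => (Submodule.eq_starProjection_of_mem_of_inner_eq_zero ?_ ?_).symm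
  · exact congrArg (fun k => toCLM k x) he
  · intro y hy
    have hy : toCLM e y = y := hy
    -- As `⟪e†y, y⟫ = ‖y‖²`, expanding gives `‖e†y - y‖² = ‖e†y‖² - ‖y‖² ≤ 0`.
    have hfix : toCLM (dagger e) y = y := by
      rw [← sub_eq_zero, ← norm_eq_zero]
      have h1 := norm_sub_sq (𝕜 := 𝕜) (toCLM (dagger e) y) y
      rw [inner_dagger_left, hy, inner_self_eq_norm_sq] at h1
      have h2 := norm_toCLM_apply_le (dagger e) y
      nlinarith [norm_nonneg (toCLM (dagger e) y), norm_nonneg y,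
        sq_nonneg ‖toCLM (dagger e) y - y‖]
    rw [← inner_conj_symm, inner_sub_right, ← inner_dagger_left, hfix, sub_self, map_zero]

theorem dagger_eq_of_idem {e : X ⟶ X} (he : e ≫ e = e) : dagger e = e := by
  rw [eq_proj_of_idem he, dagger_proj]

/-- Compatible contractions on a directed family of closed subspaces have a common extension. -/
theorem exists_glue {ι : Type*} [Preorder ι] [IsDirectedOrder ι] [Nonempty ι]
    (V : ι → ClosedSubmodule 𝕜 X) (hV : Monotone V) (h : ι → (X ⟶ Y))
    (hh : ∀ i j, i ≤ j → proj (V i) ≫ h j = h i) :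
    ∃ H : X ⟶ Y, (∀ i, proj (V i) ≫ H = h i) ∧ proj (⨆ i, V i) ≫ H = H := by
  have hp (x : X) : Filter.Tendsto (fun i => toCLM (proj (V i)) x) Filter.atTop
      (nhds (toCLM (proj (⨆ i, V i)) x)) := by
    have e : (⨆ i, V i).toSubmodule = (⨆ i, (V i).toSubmodule).topologicalClosure := by
      rw [ClosedSubmodule.toSubmodule_iSup]; rfl
    have : (⨆ i, (V i).toSubmodule).topologicalClosure.HasOrthogonalProjection := by
      rw [← e]; infer_instance
    have := Submodule.starProjection_tendsto_closure_iSup (fun i => (V i).toSubmodule)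
      (fun i j hij => hV hij) x
    convert! this using 2
    change (⨆ i, V i).toSubmodule.starProjection x = _
    congr! 2
  -- For `m` above `i` and `j`, `h i x - h j x` is `h m` applied to a difference of projections of
  -- `x`; contractivity makes the net Cauchy.
  have hlim (x : X) : ∃ y, Filter.Tendsto (fun i => toCLM (h i) x) Filter.atTop (nhds y) := by
    have hc := (hp x).cauchy_map
    rw [cauchy_map_iff', tendsto_uniformity_iff_dist_tendsto_zero] at hc
    refine cauchy_map_iff_exists_tendsto.1 ?_
    rw [cauchy_map_iff', tendsto_uniformity_iff_dist_tendsto_zero]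
    refine squeeze_zero (fun _ => dist_nonneg) (fun ij => ?_) hc
    obtain ⟨m, hi, hj⟩ := exists_ge_ge ij.1 ij.2
    rw [← hh _ _ hi, ← hh _ _ hj, dist_eq_norm, dist_eq_norm, toCLM_comp, toCLM_comp, ← map_sub]
    exact norm_toCLM_apply_le _ _
  choose H hH using hlim
  let L : X →ₗ[𝕜] Y := linearMapOfTendsto H (fun i => (toCLM (h i) : X →ₗ[𝕜] Y))
    (tendsto_pi_nhds.2 hH)
  have hL : ∀ x, ‖L x‖ ≤ 1 * ‖x‖ := fun x =>
    le_of_tendsto (hH x).norm (.of_forall fun i => by simpa using norm_toCLM_apply_le (h i) x)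
  let M : X ⟶ Y := ofCLM (L.mkContinuous 1 hL) (L.mkContinuous_norm_le zero_le_one hL)
  have hM : ∀ x, toCLM M x = H x := fun x => rfl
  have h1 : ∀ i, proj (V i) ≫ M = h i := fun i => hom_ext fun x => by
    rw [toCLM_comp, hM]
    refine tendsto_nhds_unique (hH _) (tendsto_const_nhds.congr' ?_)
    filter_upwards [Filter.eventually_ge_atTop i] with j hj
    rw [← hh i j hj, toCLM_comp]
  refine ⟨M, h1, hom_ext fun x => ?_⟩
  rw [hM x]
  refine tendsto_nhds_unique (((toCLM M).continuous.tendsto _).comp (hp x)) ?_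
  refine (hH x).congr fun i => ?_
  rw [← h1 i]
  rfl

/-! ### The least fixed subspace -/

section FixedSpace

variable (S : HilbLE.{v} 𝕜 c ⥤ HilbLE.{v} 𝕜 c) (j : S.obj Z ⟶ Z) (r : Z ⟶ S.obj Z)

/-- The image under `j` of `S` applied to a closed subspace. -/
def image (V : ClosedSubmodule 𝕜 Z) : ClosedSubmodule 𝕜 Z :=
  eqLocus (r ≫ S.map (proj V) ≫ j) (𝟙 Z)

variable {S j r} (hj : j ≫ r = 𝟙 _)

include hj

theorem retract_comp (f : Z ⟶ Z) (g : Z ⟶ X) (k : S.obj X ⟶ A) :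
    (r ≫ S.map f ≫ j) ≫ r ≫ S.map g ≫ k = r ≫ S.map (f ≫ g) ≫ k := by
  simp only [Category.assoc, Functor.map_comp, reassoc_of% hj]

theorem proj_image (V : ClosedSubmodule 𝕜 Z) :
    proj (image S j r V) = r ≫ S.map (proj V) ≫ j :=
  (eq_proj_of_idem (by rw [retract_comp hj, proj_idem])).symm

theorem image_mono : Monotone (image S j r) := by
  intro V W h
  have := proj_comp_eq_iff (V := image S j r V) (f := r ≫ S.map (proj W) ≫ j) (g := 𝟙 Z)
  refine this.1 ?_
  rw [proj_image hj, retract_comp hj, proj_comp_proj h, Category.comp_id]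

/-- The least closed subspace that is stable under `image`. -/
def leastImage : ClosedSubmodule 𝕜 Z := OrderHom.lfp ⟨image S j r, image_mono hj⟩

theorem image_leastImage : image S j r (leastImage hj) = leastImage hj :=
  OrderHom.map_lfp ⟨image S j r, image_mono hj⟩

theorem leastImage_le {V : ClosedSubmodule 𝕜 Z} (h : image S j r V ≤ V) : leastImage hj ≤ V :=
  OrderHom.lfp_le ⟨image S j r, image_mono hj⟩ h

theorem proj_leastImage : r ≫ S.map (proj (leastImage hj)) ≫ j = proj (leastImage hj) := by
  rw [← proj_image hj, image_leastImage]

end FixedSpace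

/-! ### Solving the recursion -/

/-- A solution of the recursion `h = r ≫ S.map h ≫ a` on a closed subspace. -/
structure PartialSolution (S : HilbLE.{v} 𝕜 c ⥤ HilbLE.{v} 𝕜 c) (j : S.obj Z ⟶ Z)
    (r : Z ⟶ S.obj Z) (a : S.obj A ⟶ A) where
  /-- the subspace on which the recursion is solved -/
  domain : ClosedSubmodule 𝕜 Z
  /-- the solution -/
  hom : Z ⟶ A
  -- This makes one step of the recursion enlarge the domain.
  le_image : domain ≤ image S j r domain
  proj_comp_hom : proj domain ≫ hom = hom
  proj_comp_step : proj domain ≫ r ≫ S.map hom ≫ a = hom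

namespace PartialSolution

variable {S : HilbLE.{v} 𝕜 c ⥤ HilbLE.{v} 𝕜 c} {j : S.obj Z ⟶ Z} {r : Z ⟶ S.obj Z}
  {a : S.obj A ⟶ A}

/-- Partial solutions are ordered by extension. -/
instance : Preorder (PartialSolution S j r a) where
  le s t := s.domain ≤ t.domain ∧ proj s.domain ≫ t.hom = s.hom
  le_refl s := ⟨le_rfl, s.proj_comp_hom⟩
  le_trans s t w hst htw := ⟨hst.1.trans htw.1, by
    rw [← hst.2, ← htw.2, ← Category.assoc, proj_comp_proj hst.1]⟩

theorem comp_step_eq (hj : j ≫ r = 𝟙 _) {V : ClosedSubmodule 𝕜 Z}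
    (hV : V ≤ image S j r V) (h : Z ⟶ A) :
    proj V ≫ r ≫ S.map h ≫ a = proj V ≫ r ≫ S.map (proj V ≫ h) ≫ a := by
  rw [← retract_comp hj, ← proj_image hj, reassoc_of% (proj_comp_proj hV)]

/-- One step of the recursion extends a partial solution. -/
def step (hj : j ≫ r = 𝟙 _) (s : PartialSolution S j r a) : PartialSolution S j r a where
  domain := image S j r s.domain
  hom := r ≫ S.map s.hom ≫ a
  le_image := image_mono hj s.le_image
  proj_comp_hom := by rw [proj_image hj, retract_comp hj, s.proj_comp_hom]
  proj_comp_step := by rw [proj_image hj, retract_comp hj, s.proj_comp_step]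

theorem le_step (hj : j ≫ r = 𝟙 _) (s : PartialSolution S j r a) : s ≤ s.step hj :=
  ⟨s.le_image, s.proj_comp_step⟩

theorem bddAbove_of_isChain (hj : j ≫ r = 𝟙 _) {C : Set (PartialSolution S j r a)}
    (hC : IsChain (· ≤ ·) C) (hne : C.Nonempty) : BddAbove C := by
  have : Nonempty C := hne.to_subtype
  have : IsDirectedOrder C := ⟨fun s t => by
    rcases hC.total s.2 t.2 with h | h
    · exact ⟨t, h, le_rfl⟩
    · exact ⟨s, le_rfl, h⟩⟩
  obtain ⟨H, hH, hH'⟩ := exists_glue (fun s : C => s.1.domain) (fun s t (h : s.1 ≤ t.1) => h.1)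
    (fun s => s.1.hom) (fun s t (h : s.1 ≤ t.1) => h.2)
  have hle : (⨆ s : C, s.1.domain) ≤ image S j r (⨆ s : C, s.1.domain) :=
    iSup_le fun s => s.1.le_image.trans
      (image_mono hj (le_iSup (fun s : C => s.1.domain) s))
  refine ⟨⟨⨆ s : C, s.1.domain, H, hle, hH', ?_⟩, fun s hs =>
    ⟨le_iSup (fun s : C => s.1.domain) ⟨s, hs⟩, hH ⟨s, hs⟩⟩⟩
  refine Eq.trans ?_ hH'
  rw [proj_comp_eq_iff]
  -- The agreement locus is a closed subspace, so each member of the chain can be checked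
  -- separately.
  refine iSup_le fun s => ?_
  rw [← proj_comp_eq_iff, comp_step_eq hj s.1.le_image, hH, s.1.proj_comp_step]

end PartialSolution

/-- The recursion `h = r ≫ S.map h ≫ a` has exactly one solution supported on the least closed
subspace stable under `image`. -/
theorem existsUnique_solution {S : HilbLE.{v} 𝕜 c ⥤ HilbLE.{v} 𝕜 c} {j : S.obj Z ⟶ Z}
    {r : Z ⟶ S.obj Z} (hj : j ≫ r = 𝟙 _) (a : S.obj A ⟶ A) :
    ∃! h : Z ⟶ A, proj (leastImage hj) ≫ h = h ∧ r ≫ S.map h ≫ a = h := by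
  refine existsUnique_of_exists_of_unique ?_ ?_
  · let s₀ : PartialSolution S j r a :=
      { domain := ⊥
        hom := ofCLM 0 (by simp)
        le_image := bot_le
        proj_comp_hom := hom_ext fun x => rfl
        proj_comp_step := hom_ext fun x => by
          have : toCLM (proj (⊥ : ClosedSubmodule 𝕜 Z)) x = 0 := proj_mem ⊥ x
          simp [this] }
    have : Nonempty (PartialSolution S j r a) := ⟨s₀⟩
    obtain ⟨m, hm⟩ := zorn_le_nonempty fun (C : Set (PartialSolution S j r a)) hC hne =>
      PartialSolution.bddAbove_of_isChain hj hC hne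
    have hstep : r ≫ S.map m.hom ≫ a = m.hom := by
      -- Maximality makes the domain a fixed point, though perhaps not the least; the solution is
      -- then cut down to the least one.
      have h1 : image S j r m.domain = m.domain :=
        le_antisymm (hm (m.le_step hj)).1 m.le_image
      refine (m.step hj).proj_comp_hom.symm.trans ?_
      change proj (image S j r m.domain) ≫ r ≫ S.map m.hom ≫ a = _
      rw [h1, m.proj_comp_step]
    refine ⟨proj (leastImage hj) ≫ m.hom, ?_, ?_⟩
    · rw [← Category.assoc, proj_idem]
    · rw [← retract_comp hj, proj_leastImage, hstep]
  · rintro h k ⟨h1, h2⟩ ⟨k1, k2⟩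
    rw [← h1, ← k1, proj_comp_eq_iff]
    refine leastImage_le hj ?_
    have hE : proj (eqLocus h k) ≫ h = proj (eqLocus h k) ≫ k := proj_comp_eq_iff.2 le_rfl
    have hs (l : Z ⟶ A) (hl : r ≫ S.map l ≫ a = l) :
        proj (image S j r (eqLocus h k)) ≫ l = r ≫ S.map (proj (eqLocus h k) ≫ l) ≫ a := by
      rw [proj_image hj, ← retract_comp hj, hl]
    rw [← proj_comp_eq_iff, hs h h2, hs k k2, hE]

/-! ### Duality by adjoints -/

/-- The conjugate of an endofunctor by the adjoint. -/
abbrev daggerConj (S : HilbLE.{v} 𝕜 c ⥤ HilbLE.{v} 𝕜 c) : HilbLE.{v} 𝕜 c ⥤ HilbLE.{v} 𝕜 c where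
  obj X := S.obj X
  map f := dagger (S.map (dagger f))
  map_id X := by simp
  map_comp f g := by simp

/-- `S` preserves idempotents, and idempotent contractions are self-adjoint. -/
theorem leastImage_daggerConj {S : HilbLE.{v} 𝕜 c ⥤ HilbLE.{v} 𝕜 c} {j : S.obj Z ⟶ Z}
    {r : Z ⟶ S.obj Z} (hj : j ≫ r = 𝟙 _) :
    leastImage (S := daggerConj S) (j := j) (r := r) hj = leastImage (S := S) hj := by
  have h : image (daggerConj S) j r = image S j r := by
    funext V
    have hV : (daggerConj S).map (proj V) = S.map (proj V) := by
      change dagger (S.map (dagger (proj V))) = _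
      rw [dagger_proj, dagger_eq_of_idem]
      rw [← S.map_comp, proj_idem]
    unfold image
    rw [hV]
  unfold leastImage
  congr 2

/-- The recursion `k = b ≫ S.map k ≫ j` has exactly one solution with values in the least closed
subspace stable under `image`. -/
theorem existsUnique_cosolution {S : HilbLE.{v} 𝕜 c ⥤ HilbLE.{v} 𝕜 c} {j : S.obj Z ⟶ Z}
    (hj : j ≫ dagger j = 𝟙 _) (b : A ⟶ S.obj A) :
    ∃! k : A ⟶ Z, k ≫ proj (leastImage hj) = k ∧ b ≫ S.map k ≫ j = k := by
  obtain ⟨h, ⟨h1, h2⟩, hu⟩ :=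
    existsUnique_solution (S := daggerConj S) (j := j) (r := dagger j) hj (dagger b)
  rw [leastImage_daggerConj hj] at h1 hu
  refine ⟨dagger h, ⟨?_, ?_⟩, ?_⟩
  · simpa using congrArg dagger h1
  · change dagger j ≫ dagger (S.map (dagger h)) ≫ dagger b = h at h2
    simpa using congrArg dagger h2
  · rintro k ⟨k1, k2⟩
    rw [← hu (dagger k) ⟨?_, ?_⟩, dagger_dagger]
    · simpa using congrArg dagger k1
    · change dagger j ≫ dagger (S.map (dagger (dagger k))) ≫ dagger b = _
      simpa using congrArg dagger k2

/-! ### Universal space and compactness -/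

/-- Every closed subspace is the image of an isometry. -/
theorem exists_splitting (V : ClosedSubmodule 𝕜 Z) :
    ∃ (U : HilbLE.{v} 𝕜 c) (i : U ⟶ Z) (p : Z ⟶ U), i ≫ p = 𝟙 U ∧ p ≫ i = proj V := by
  have : CompleteSpace V.toSubmodule := V.isClosed.completeSpace_coe
  let U : HilbLE.{v} 𝕜 c := ⟨V.toSubmodule, V.hilbertDim_le.trans Z.dim_le⟩
  refine ⟨U, ofCLM (X := U) V.toSubmodule.subtypeL V.toSubmodule.norm_subtypeL_le,
    ofCLM (Y := U) V.toSubmodule.orthogonalProjectionOnto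
      V.toSubmodule.orthogonalProjectionOnto_norm_le, ?_, rfl⟩
  exact hom_ext fun x => V.toSubmodule.orthogonalProjectionOnto_mem_subspace_eq_self x

variable (𝕜 c) in
/-- Some Hilbert space of dimension at most `c` contains all others. -/
theorem exists_universal : ∃ Z : HilbLE.{v} 𝕜 c, ∀ X : HilbLE.{v} 𝕜 c,
    ∃ j : X ⟶ Z, j ≫ dagger j = 𝟙 X := by
  let b : HilbertBasis c.out 𝕜 (lp (fun _ : c.out => 𝕜) 2) := ⟨LinearIsometryEquiv.refl 𝕜 _⟩
  let Z : HilbLE.{v} 𝕜 c := ⟨lp (fun _ : c.out => 𝕜) 2,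
    (hilbertDim_le_iff 𝕜 _ _).2 ⟨c.out, ⟨b⟩, c.mk_out.le⟩⟩
  refine ⟨Z, fun X => ?_⟩
  obtain ⟨ι, ⟨b'⟩, hι⟩ := (hilbertDim_le_iff 𝕜 X c).1 X.dim_le
  rw [← c.mk_out] at hι
  obtain ⟨f⟩ := hι
  let L : X →ₗᵢ[𝕜] Z :=
    (b.orthonormal.comp f f.injective).orthogonalFamily.linearIsometry.comp
      b'.repr.toLinearIsometry
  refine ⟨ofCLM L.toContinuousLinearMap L.norm_toContinuousLinearMap_le, ?_⟩
  refine hom_ext fun x => ext_inner_right 𝕜 fun y => ?_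
  rw [toCLM_comp, inner_dagger_left]
  exact L.inner_map_map x y

/-- Every endofunctor of the category of Hilbert spaces of bounded dimension and contractions is
algebraically compact. -/
theorem isAlgebraicallyCompact (S : HilbLE.{v} 𝕜 c ⥤ HilbLE.{v} 𝕜 c) :
    IsAlgebraicallyCompact S := by
  obtain ⟨Z, hZ⟩ := exists_universal 𝕜 c
  obtain ⟨j, hj⟩ := hZ (S.obj Z)
  obtain ⟨U, i, p, hip, hpi⟩ := exists_splitting (leastImage (S := S) hj)
  have hP := proj_leastImage (S := S) hj
  rw [← hpi] at hP
  have hS : S.map i ≫ S.map p = 𝟙 _ := by rw [← S.map_comp, hip, S.map_id]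
  have hjP : j ≫ p ≫ i = S.map (p ≫ i) ≫ j := by
    conv_lhs => rw [← hP, reassoc_of% hj]
  have hPr : p ≫ i ≫ dagger j = dagger j ≫ S.map (p ≫ i) := by
    rw [← Category.assoc]
    conv_lhs => rw [← hP]
    simp only [Category.assoc, hj, Category.comp_id]
  let ω : S.obj U ≅ U :=
    { hom := S.map i ≫ j ≫ p
      inv := i ≫ dagger j ≫ S.map p
      hom_inv_id := by
        simp only [Category.assoc]
        rw [reassoc_of% hPr, reassoc_of% hj]
        simp [hS]
      inv_hom_id := by
        simp only [Category.assoc]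
        rw [S.map_comp, Category.assoc] at hP
        rw [reassoc_of% hP]
        simp [hip] }
  refine ⟨U, ω, ⟨?_⟩, ⟨?_⟩⟩
  -- `H ↦ i ≫ H` and `h ↦ p ≫ h` match supported solutions with algebra maps.
  · have key : ∀ A : Endofunctor.Algebra S,
        ∃! h : U ⟶ A.a, S.map h ≫ A.str = ω.hom ≫ h := by
      intro A
      obtain ⟨H, ⟨H1, H2⟩, hu⟩ := existsUnique_solution (S := S) hj A.str
      rw [← hpi] at H1 hu
      refine ⟨i ≫ H, ?_, ?_⟩
      · change _ = (S.map i ≫ j ≫ p) ≫ i ≫ H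
        rw [Category.assoc] at H1
        simp only [Category.assoc, H1]
        conv_rhs => rw [← H2, reassoc_of% hj]
        simp
      · intro h hh
        change S.map h ≫ _ = (S.map i ≫ j ≫ p) ≫ h at hh
        have := hu (p ≫ h) ⟨by simp [reassoc_of% hip], by
          rw [S.map_comp, Category.assoc, hh]
          rw [S.map_comp, Category.assoc] at hP
          simp only [Category.assoc]
          rw [reassoc_of% hP, reassoc_of% hip]⟩
        rw [← this, reassoc_of% hip]
    choose h hh hu using key
    exact Limits.IsInitial.ofUniqueHom (fun A => ⟨h A, hh A⟩)
      (fun A m => Endofunctor.Algebra.Hom.ext (hu A m.f m.h))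
  · have key : ∀ B : Endofunctor.Coalgebra S,
        ∃! k : B.V ⟶ U, B.str ≫ S.map k = k ≫ ω.inv := by
      intro B
      obtain ⟨K, ⟨K1, K2⟩, hu⟩ := existsUnique_cosolution (S := S) hj B.str
      rw [← hpi] at K1 hu
      refine ⟨K ≫ p, ?_, ?_⟩
      · change _ = (K ≫ p) ≫ i ≫ dagger j ≫ S.map p
        simp only [Category.assoc]
        rw [reassoc_of% K1]
        conv_rhs => rw [← K2]
        simp [reassoc_of% hj]
      · intro k hk
        change _ = k ≫ i ≫ dagger j ≫ S.map p at hk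
        have := hu (k ≫ i) ⟨by simp [reassoc_of% hip], by
          rw [S.map_comp]
          simp only [Category.assoc]
          rw [reassoc_of% hk]
          rw [S.map_comp, Category.assoc] at hP
          rw [hP, reassoc_of% hip]⟩
        rw [← this, Category.assoc, hip, Category.comp_id]
    choose k hk hu using key
    exact Limits.IsTerminal.ofUniqueHom (fun B => ⟨k B, hk B⟩)
      (fun B m => Endofunctor.Coalgebra.Hom.ext (hu B m.f m.h))

end HilbLE

/-! ### Transfer along a factorization -/

/-- If `G ⋙ F` is algebraically compact then so is every functor isomorphic to `F ⋙ G`. -/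
theorem IsAlgebraicallyCompact.comp_swap {C : Type*} [Category* C] {D : Type*} [Category* D]
    {F : C ⥤ D} {G : D ⥤ C} (h : IsAlgebraicallyCompact (G ⋙ F)) {T : C ⥤ C} (e : T ≅ F ⋙ G) :
    IsAlgebraicallyCompact T := by
  obtain ⟨U, ω, ⟨hI⟩, ⟨hT⟩⟩ := h
  refine ⟨G.obj U, e.app (G.obj U) ≪≫ G.mapIso ω, ⟨?_⟩, ⟨?_⟩⟩
  · have key : ∀ A : Endofunctor.Algebra T,
        ∃! h : G.obj U ⟶ A.a, T.map h ≫ A.str = (e.app (G.obj U) ≪≫ G.mapIso ω).hom ≫ h := by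
      intro A
      let a : G.obj (F.obj A.a) ⟶ A.a := e.inv.app A.a ≫ A.str
      have ha : A.str = e.hom.app A.a ≫ a := by simp [a]
      let A' : Endofunctor.Algebra (G ⋙ F) := ⟨F.obj A.a, F.map a⟩
      have hf := (hI.to A').h
      change F.map (G.map (hI.to A').f) ≫ F.map a = ω.hom ≫ (hI.to A').f at hf
      refine ⟨G.map (hI.to A').f ≫ a, ?_, ?_⟩
      · have := congrArg G.map hf
        simp only [Functor.map_comp] at this
        change T.map _ ≫ _ = _
        rw [ha, e.hom.naturality_assoc]
        simp [reassoc_of% this]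
      · intro k hk
        rw [ha, e.hom.naturality_assoc] at hk
        simp only [Iso.trans_hom, Iso.app_hom, Functor.mapIso_hom, Category.assoc,
          cancel_epi, Functor.comp_map] at hk
        -- Any competitor `k` induces an algebra map `U ⟶ F.obj A.a`, which recovers `k` after
        -- `G.map` and `a`.
        have hm : F.map (G.map (ω.inv ≫ F.map k)) ≫ F.map a = ω.hom ≫ ω.inv ≫ F.map k := by
          rw [← F.map_comp, G.map_comp, Category.assoc, hk, ← G.map_comp_assoc]
          simp
        have := hI.hom_ext (hI.to A') ⟨ω.inv ≫ F.map k, hm⟩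
        rw [this]
        simp [hk, ← G.map_comp_assoc]
    choose h hh hu using key
    exact Limits.IsInitial.ofUniqueHom (fun A => ⟨h A, hh A⟩)
      (fun A m => Endofunctor.Algebra.Hom.ext (hu A m.f m.h))
  · have key : ∀ B : Endofunctor.Coalgebra T,
        ∃! k : B.V ⟶ G.obj U,
          B.str ≫ T.map k = k ≫ (e.app (G.obj U) ≪≫ G.mapIso ω).inv := by
      intro B
      let b : B.V ⟶ G.obj (F.obj B.V) := B.str ≫ e.hom.app B.V
      have hb : B.str = b ≫ e.inv.app B.V := by simp [b]
      let B' : Endofunctor.Coalgebra (G ⋙ F) := ⟨F.obj B.V, F.map b⟩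
      have hf := (hT.from B').h
      change F.map b ≫ F.map (G.map (hT.from B').f) = (hT.from B').f ≫ ω.inv at hf
      refine ⟨b ≫ G.map (hT.from B').f, ?_, ?_⟩
      · have := congrArg G.map hf
        simp only [Functor.map_comp] at this
        change _ ≫ T.map _ = _
        rw [hb, Category.assoc, ← e.inv.naturality]
        simp [reassoc_of% this]
      · intro k hk
        rw [hb, Category.assoc, ← e.inv.naturality] at hk
        simp only [Iso.trans_inv, Iso.app_inv, Functor.mapIso_inv, ← Category.assoc,
          cancel_mono, Functor.comp_map] at hk
        have hm : F.map b ≫ F.map (G.map (F.map k ≫ ω.hom)) = (F.map k ≫ ω.hom) ≫ ω.inv := by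
          rw [← F.map_comp, G.map_comp, ← Category.assoc, hk, Category.assoc, ← G.map_comp]
          simp
        have hk' : b ≫ G.map (F.map k) = k ≫ G.map ω.inv := hk
        have := hT.hom_ext (hT.from B') ⟨F.map k ≫ ω.hom, hm⟩
        rw [this]
        rw [G.map_comp, reassoc_of% hk', ← G.map_comp]
        simp
    choose k hk hu using key
    exact Limits.IsTerminal.ofUniqueHom (fun B => ⟨k B, hk B⟩)
      (fun B m => Endofunctor.Coalgebra.Hom.ext (hu B m.f m.h))

end

theorem mainTheorem8 (𝕜 : Type) [RCLike 𝕜] (c : Cardinal.{v}) (T : Type u ⥤ Type u)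
    (F : Type u ⥤ HilbLE.{v} 𝕜 c) (G : HilbLE.{v} 𝕜 c ⥤ Type u) (e : T ≅ F ⋙ G) :
    IsAlgebraicallyCompact T :=
  (HilbLE.isAlgebraicallyCompact (G ⋙ F)).comp_swap e
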